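/- Let $c,n,m\ge 1$ be integers. For a collection $\mathcal X=(X_1,\dots,X_m)$ of subsets (repetitions allowed) of an $n$-element set and a permutation $\pi$ of $\{1,\dots,m\}$ put $$\Delta(\mathcal X,\pi,k)=\Bigl|\bigcup_{i=1}^{k}X_{\pi(i)}\Bigr|-k\quad(1\le k\le m),\qquad \Delta(\mathcal X,\pi)=\max_{1\le k\le m}\Delta(\mathcal X,\pi,k),\qquad \Delta(\mathcal X)=\min_{\pi}\Delta(\mathcal X,\pi),$$ and let $f_c(n,m)=\max_{\mathcal X}\Delta(\mathcal X)$, the maximum being over all collections $\mathcal X=(X_1,\dots,X_m)$ of subsets of an $n$-element set with $|X_i|\le c$ for all $i$. Then $f_3(n,n)\ge 0.0818757697\,n$ for all sufficiently large $n$, and $f_3(n,n)\le\lceil n/4\rceil+2$ for all $n\ge 3$. In particular $f_3(n,n)$ grows linearly in $n$: $f_3(n,n)=\Theta(n)$ as $n\to\infty$. -/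

import Mathlib

/-- `Δ(𝒳, π, k) = |X_{π(1)} ∪ ⋯ ∪ X_{π(k)}| - k`, for a collection `𝒳 = (X_1, …, X_m)` of subsets
of an `n`-element set (an indexed family, so that sets may be repeated) and an ordering `π`. The
indices here run over `0, …, m - 1`, so the first `k` positions are those `i` with `i < k`. -/
def deltaAt {n m : ℕ} (X : Fin m → Finset (Fin n)) (π : Equiv.Perm (Fin m)) (k : ℕ) : ℤ :=
  ((((Finset.univ.filter fun i : Fin m => (i : ℕ) < k).biUnion fun i => X (π i)).card : ℕ) : ℤ) - k

/-- `Δ(𝒳, π) = max_{1 ≤ k ≤ m} Δ(𝒳, π, k)`. -/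
noncomputable def deltaOrder {n m : ℕ} (X : Fin m → Finset (Fin n))
    (π : Equiv.Perm (Fin m)) : ℤ :=
  sSup (deltaAt X π '' Set.Icc 1 m)

/-- `Δ(𝒳) = min_π Δ(𝒳, π)`, over all orderings `π`. -/
noncomputable def deltaMin {n m : ℕ} (X : Fin m → Finset (Fin n)) : ℤ :=
  sInf (Set.range (deltaOrder X))

/-- The collections of `m` subsets of size at most `c` of an `n`-element set. -/
def setFamilies (c n m : ℕ) : Set (Fin m → Finset (Fin n)) :=
  {X | ∀ i, (X i).card ≤ c}

/-- `f_c(n, m) = max_𝒳 Δ(𝒳)`, over all collections of `m` subsets of size at most `c` of an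
`n`-element set. -/
noncomputable def orderingExponent (c n m : ℕ) : ℤ :=
  sSup (deltaMin '' setFamilies c n m)

/-- For `m ≥ 1` the supremum in `deltaOrder` is a maximum. -/
theorem isGreatest_deltaOrder {n m : ℕ} (hm : 1 ≤ m) (X : Fin m → Finset (Fin n))
    (π : Equiv.Perm (Fin m)) :
    IsGreatest (deltaAt X π '' Set.Icc 1 m) (deltaOrder X π) := by
  have hf : (deltaAt X π '' Set.Icc 1 m).Finite := (Set.finite_Icc 1 m).image _
  have hne : (deltaAt X π '' Set.Icc 1 m).Nonempty := ⟨_, 1, ⟨le_refl 1, hm⟩, rfl⟩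
  exact ⟨hne.csSup_mem hf, fun _ h => le_csSup hf.bddAbove h⟩

/-- The infimum in `deltaMin` is a minimum. -/
theorem isLeast_deltaMin {n m : ℕ} (X : Fin m → Finset (Fin n)) :
    IsLeast (Set.range (deltaOrder X)) (deltaMin X) := by
  have hf : (Set.range (deltaOrder X)).Finite := Set.finite_range _
  exact ⟨(Set.range_nonempty _).csInf_mem hf, fun _ h => csInf_le hf.bddBelow h⟩

/-- The supremum in `orderingExponent` is a maximum. -/
theorem isGreatest_orderingExponent (c n m : ℕ) :
    IsGreatest (deltaMin '' setFamilies c n m) (orderingExponent c n m) := by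
  have hf : (deltaMin '' setFamilies c n m).Finite := (Set.toFinite _).image _
  have hne : (deltaMin '' setFamilies c n m).Nonempty :=
    ⟨_, fun _ => ∅, fun _ => by simp, rfl⟩
  exact ⟨hne.csSup_mem hf, fun _ h => le_csSup hf.bddAbove h⟩

/-!
The lower bound is a union bound over a random 3-regular family: a uniform permutation `σ` of
`Fin n × Fin 3` matches the three slots of each of `n` sets with three copies of each of `n`
elements. A given set of `3k` slots lands in the copies of a given set of `u` elements with
probability `C(3u, 3k) / C(3n, 3k)` (`card_perm_image_subset_mul`). With `u = n - k` the expected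
number of pairs consisting of `k` sets and `u` elements containing their union is
`C(n, k)² C(3(n-k), 3k) / C(3n, 3k)`. For `k ≈ (1 - δ) n / 2` this is `exp (n r + O(log n))`,
where the rate `r` is `unionRate ((1 - δ) / 2)`, and `r < 0` for `δ = 0.0818757697`
(`unionRate_neg`). So for large `n` some family has all unions of `k` members larger than `n - k`,
and every ordering reaches `n - 2k + 1 ≥ δ n` at position `k`.

For the upper bound, elements are ordered instead of sets: an increasing chain of subsets, one new
element at a time, lists each set when it is swallowed, and `Δ` is at most the largest value of
`gap X U = |U| - #{i | X i ⊆ U}` along the chain (`deltaMin_le_of_path`). Given `U`, join two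
outside elements when some set lacks exactly these two. A connected component is added by raising
the gap by one for its first element and never again (`component_path`). If each of the `τ`
components raises the gap `g ≥ 1`, a count shows that `τ + g` sets lie in no single component.
These have three elements, avoid `U` and meet two components each, so that some component meets
at least three of them (`exists_block_touching_three`). Hence each new unit of gap beyond the first
is paid for by three newly touched sets, while at least `g` sets are still untouched; together
`3 (g - 1) + g ≤ n`, which gives the bound `n / 4` up to a constant (`exists_growth`).
-/

open Filter Topology

/-! ### The exponential rate of the union bound -/

/-- The upper half of Stirling's estimate for `log n!`, with a logarithmic error. -/
lemma log_factorial_le (n : ℕ) :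
    Real.log (n.factorial : ℝ) ≤ n * Real.log n - n + (Real.log (n + 1) + 1) := by
  suffices H : ∀ n : ℕ, Real.log ((n + 1).factorial : ℝ) ≤
      (n + 1) * Real.log (n + 1) - (n + 1) + (Real.log (n + 1) + 1) by
    rcases n with _ | n
    · simp
    · have h := H n
      have h2 : Real.log ((n : ℝ) + 1) ≤ Real.log ((n : ℝ) + 1 + 1) :=
        Real.log_le_log (by positivity) (by linarith)
      push_cast
      linarith
  intro n
  induction n with
  | zero => simp
  | succ n ih =>
    have e : Real.log ((n + 1 + 1).factorial : ℝ) =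
        Real.log ((n : ℝ) + 1 + 1) + Real.log ((n + 1).factorial : ℝ) := by
      rw [Nat.factorial_succ (n + 1), Nat.cast_mul, Real.log_mul (by positivity) (by positivity)]
      push_cast
      ring
    rw [e]
    -- `log ((n + 2) / (n + 1)) ≥ 1 - (n + 1) / (n + 2)`
    have h1 := Real.log_le_sub_one_of_pos (show (0 : ℝ) < (n + 1) / (n + 1 + 1) by positivity)
    rw [Real.log_div (by positivity) (by positivity)] at h1
    have h2 : ((n : ℝ) + 1 + 1) * (Real.log (n + 1) - Real.log (n + 1 + 1)) ≤
        ((n : ℝ) + 1 + 1) * ((n + 1) / (n + 1 + 1) - 1) :=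
      mul_le_mul_of_nonneg_left h1 (by positivity)
    have h3 : ((n : ℝ) + 1 + 1) * ((n + 1) / (n + 1 + 1) - 1) = -1 := by
      field_simp
      ring
    push_cast
    linarith

lemma le_log_factorial (n : ℕ) :
    n * Real.log n - n ≤ Real.log (n.factorial : ℝ) := by
  rcases Nat.eq_zero_or_pos n with rfl | hn
  · simp
  · have h := Real.pow_div_factorial_le_exp (x := (n : ℝ)) (by positivity) n
    have h2 := Real.log_le_log (by positivity) h
    rw [Real.log_exp, Real.log_div (by positivity) (by positivity), Real.log_pow] at h2
    linarith

lemma log_choose {n k : ℕ} (h : k ≤ n) :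
    Real.log (n.choose k : ℝ) = Real.log (n.factorial : ℝ) - Real.log (k.factorial : ℝ) -
      Real.log ((n - k).factorial : ℝ) := by
  have hc : (0 : ℝ) < n.choose k := by exact_mod_cast Nat.choose_pos h
  rw [← Nat.choose_mul_factorial_mul_factorial h, Nat.cast_mul, Nat.cast_mul,
    Real.log_mul (by positivity) (by positivity), Real.log_mul (by positivity) (by positivity)]
  ring

/-- The exponential rate of `C(n, k)² C(3(n-k), 3k) / C(3n, 3k)` for `k ≈ a n`. -/
noncomputable def unionRate (a : ℝ) : ℝ :=
  4 * ((1 - a) * Real.log (1 - a)) - 2 * (a * Real.log a) -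
    3 * ((1 - 2 * a) * Real.log (1 - 2 * a))

lemma continuous_unionRate : Continuous unionRate := by
  have h := Real.continuous_mul_log
  unfold unionRate
  exact ((continuous_const.mul (h.comp (by fun_prop : Continuous fun a : ℝ => 1 - a))).sub
    (continuous_const.mul h)).sub
    (continuous_const.mul (h.comp (by fun_prop : Continuous fun a : ℝ => 1 - 2 * a)))

/-- `x log x` along the ray through `n`, the junk value `log 0 = 0` included. -/
lemma scaled_mul_log {n : ℝ} (hn : 0 < n) (c : ℝ) :
    (n * c) * Real.log (n * c) = n * (c * Real.log c) + n * c * Real.log n := by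
  rcases eq_or_ne c 0 with rfl | hc
  · simp
  · rw [Real.log_mul hn.ne' hc]
    ring

/-- Comparison of the expected number of bad pairs with its exponential rate. -/
lemma log_union_bound_le {n k : ℕ} (hn : 0 < n) (hk : 2 * k ≤ n) :
    2 * Real.log (n.choose k : ℝ) + Real.log ((3 * (n - k)).choose (3 * k) : ℝ) -
      Real.log ((3 * n).choose (3 * k) : ℝ) ≤
    n * unionRate (k / n) + 4 * (Real.log (3 * n + 1) + 1) := by
  obtain ⟨d, rfl⟩ := Nat.exists_eq_add_of_le hk
  rw [log_choose (by omega), log_choose (by omega), log_choose (by omega)]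
  have e1 : 2 * k + d - k = k + d := by omega
  have e2 : 3 * (2 * k + d - k) - 3 * k = 3 * d := by omega
  have e3 : 3 * (2 * k + d) - 3 * k = 3 * (k + d) := by omega
  rw [e2, e3, e1]
  have a1 := log_factorial_le (2 * k + d)
  have a2 := log_factorial_le (3 * (k + d))
  have b1 := le_log_factorial k
  have b2 := le_log_factorial (k + d)
  have b3 := le_log_factorial (3 * d)
  have b4 := le_log_factorial (3 * (2 * k + d))
  obtain ⟨N, hN⟩ : ∃ N : ℝ, N = 2 * k + d := ⟨_, rfl⟩
  have hN0 : 0 < N := by rw [hN]; exact_mod_cast hn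
  obtain ⟨a, ha⟩ : ∃ a : ℝ, a = k / N := ⟨_, rfl⟩
  have hka : (k : ℝ) = N * a := by rw [ha]; field_simp
  have hda : (d : ℝ) = N * (1 - 2 * a) := by linarith
  have c1 : Real.log ((N : ℝ) + 1) ≤ Real.log (3 * N + 1) :=
    Real.log_le_log (by positivity) (by linarith)
  have c2 : Real.log (3 * (N * (1 - a)) + 1) ≤ Real.log (3 * N + 1) := by
    have h1 : 0 ≤ N * (1 - a) := by
      have : N * (1 - a) = k + d := by linarith
      rw [this]; positivity
    have h2 : 0 ≤ N * a := by rw [← hka]; positivity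
    exact Real.log_le_log (by linarith) (by linarith)
  have L3 : ∀ x : ℝ, (3 * x) * Real.log (3 * x) = 3 * (x * Real.log x) + 3 * x * Real.log 3 :=
    fun x => scaled_mul_log (by norm_num) x
  push_cast at a1 a2 b1 b2 b3 b4 ⊢
  have hkd : (k : ℝ) + d = N * (1 - a) := by linarith
  rw [hkd] at a2 b2
  rw [← hN] at a1 b4 ⊢
  rw [L3] at a2 b3 b4
  rw [hda] at b3
  rw [hka] at b1
  rw [scaled_mul_log hN0] at a2 b1 b2 b3
  rw [← ha]
  unfold unionRate
  linarith

/-- The rate is negative at `a = (1 - δ) / 2` for `δ = 0.0818757697`; it vanishes at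
`δ = 0.08187576972…`, so that the logarithms are needed up to about `10⁻¹⁰`. -/
lemma unionRate_neg : unionRate ((1 - 0.0818757697) / 2) < 0 := by
  have h1 := Real.log_div_le_sum_range_add (x := 0.0818757697 / 2.0818757697)
    (by norm_num) (by norm_num) 5
  have h2 := Real.log_div_le_sum_range_add (x := 0.0818757697 / (2 - 0.0818757697))
    (by norm_num) (by norm_num) 5
  have h3 := Real.sum_range_le_log_div
    (x := (16 * 0.0818757697 - 1) / (16 * 0.0818757697 + 1)) (by norm_num) (by norm_num) 6
  have h4 := Real.log_two_gt_d9
  have e1 : ((1 : ℝ) + 0.0818757697 / 2.0818757697) / (1 - 0.0818757697 / 2.0818757697) =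
      1.0818757697 := by norm_num
  have e2 : ((1 : ℝ) + 0.0818757697 / (2 - 0.0818757697)) /
      (1 - 0.0818757697 / (2 - 0.0818757697)) = (0.9181242303)⁻¹ := by norm_num
  have e3 : ((1 : ℝ) + (16 * 0.0818757697 - 1) / (16 * 0.0818757697 + 1)) /
      (1 - (16 * 0.0818757697 - 1) / (16 * 0.0818757697 + 1)) = 2 ^ 4 * 0.0818757697 := by norm_num
  rw [e1] at h1
  rw [e2, Real.log_inv] at h2
  rw [e3, Real.log_mul (by norm_num) (by norm_num), Real.log_pow] at h3
  norm_num [Finset.sum_range_succ] at h1 h2 h3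
  unfold unionRate
  have f1 : (1 : ℝ) - (1 - 0.0818757697) / 2 = 1.0818757697 / 2 := by norm_num
  have f2 : (1 : ℝ) - 2 * ((1 - 0.0818757697) / 2) = 0.0818757697 := by norm_num
  have f3 : ((1 : ℝ) - 0.0818757697) / 2 = 0.9181242303 / 2 := by norm_num
  rw [f1, f2, f3, Real.log_div (by norm_num) (by norm_num),
    Real.log_div (by norm_num) (by norm_num)]
  norm_num at h4 ⊢
  linarith

/-- For `k = ⌊(1 - δ) n / 2⌋` and large `n`, fewer than one bad pair is expected. -/
lemma eventually_union_bound :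
    ∀ᶠ n : ℕ in atTop, ∀ k : ℕ, k = ⌊(1 - 0.0818757697) / 2 * (n : ℝ)⌋₊ →
      n.choose k * n.choose k * (3 * (n - k)).choose (3 * k) < (3 * n).choose (3 * k) := by
  have hfl : Tendsto (fun n : ℕ => (⌊(1 - 0.0818757697) / 2 * (n : ℝ)⌋₊ : ℝ) / (n : ℝ)) atTop
      (𝓝 ((1 - 0.0818757697) / 2)) :=
    (tendsto_nat_floor_mul_div_atTop (by norm_num)).comp tendsto_natCast_atTop_atTop
  have hr := (continuous_unionRate.tendsto _).comp hfl
  obtain ⟨ε, hε, hε'⟩ : ∃ ε : ℝ, 0 < ε ∧ unionRate ((1 - 0.0818757697) / 2) < -ε :=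
    ⟨-unionRate ((1 - 0.0818757697) / 2) / 2, by linarith [unionRate_neg],
      by linarith [unionRate_neg]⟩
  have hlog : Tendsto (fun n : ℕ => Real.log (3 * n + 1) / (3 * n + 1)) atTop (𝓝 0) := by
    have h : Tendsto (fun x : ℝ => Real.log x / x) atTop (𝓝 0) := by
      simpa using Real.isLittleO_log_id_atTop.tendsto_div_nhds_zero
    refine h.comp ?_
    exact tendsto_atTop_add_const_right _ _
      (tendsto_natCast_atTop_atTop.const_mul_atTop (by norm_num))
  have hbig : ∀ᶠ n : ℕ in atTop, (ε / 64)⁻¹ * 1 < (n : ℝ) :=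
    tendsto_natCast_atTop_atTop.eventually_gt_atTop _
  filter_upwards [hr.eventually_lt_const hε', hlog.eventually_lt_const
    (show (0 : ℝ) < ε / 64 by positivity), hbig, eventually_gt_atTop 0] with n h1 h2 h3 hn k hk
  simp only [Function.comp_apply] at h1
  rw [← hk] at h1
  have hn' : (1 : ℝ) ≤ n := by exact_mod_cast hn
  have hkn : 2 * k ≤ n := by
    have : (k : ℝ) ≤ (1 - 0.0818757697) / 2 * (n : ℝ) := by
      rw [hk]; exact Nat.floor_le (by positivity)
    have : 2 * (k : ℝ) ≤ n := by nlinarith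
    exact_mod_cast this
  have key := log_union_bound_le hn hkn
  rw [div_lt_iff₀ (by positivity)] at h2
  rw [inv_mul_lt_iff₀ (by positivity)] at h3
  have h4 : (n : ℝ) * unionRate (k / n) < n * -ε := by gcongr
  have p1 : (0 : ℝ) < n.choose k := by exact_mod_cast Nat.choose_pos (by omega)
  have p2 : (0 : ℝ) < (3 * (n - k)).choose (3 * k) := by exact_mod_cast Nat.choose_pos (by omega)
  have p3 : (0 : ℝ) < (3 * n).choose (3 * k) := by exact_mod_cast Nat.choose_pos (by omega)
  have : Real.log ((n.choose k : ℝ) * n.choose k * (3 * (n - k)).choose (3 * k)) <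
      Real.log ((3 * n).choose (3 * k) : ℝ) := by
    rw [Real.log_mul (by positivity) (by positivity), Real.log_mul (by positivity) (by positivity)]
    nlinarith
  exact_mod_cast (Real.log_lt_log_iff (by positivity) p3).1 this

/-! ### Random permutations and prescribed sets -/

section Counting

variable {α : Type*} [Fintype α] [DecidableEq α]

/-- Permutations taking `A` onto a prescribed set `B` of the same size are as many as those
preserving `A`. -/
lemma card_perm_image_eq (A B : Finset α) (h : A.card = B.card) :
    (Finset.univ.filter fun σ : Equiv.Perm α => A.image σ = B).card =
      (Finset.univ.filter fun σ : Equiv.Perm α => A.image σ = A).card := by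
  have hp : MulAction.IsPretransitive (Equiv.Perm α) (Set.powersetCard α A.card) :=
    Set.powersetCard.isPretransitive
  obtain ⟨τ, hτ⟩ := hp.exists_smul_eq ⟨A, rfl⟩ ⟨B, h.symm⟩
  have hτ' : A.image τ = B := by
    exact congrArg Subtype.val hτ
  symm
  refine Finset.card_bij' (fun σ _ => τ * σ) (fun σ _ => τ⁻¹ * σ) ?_ ?_ ?_ ?_
  · intro σ hσ
    simp only [Finset.mem_filter, Finset.mem_univ, true_and] at hσ ⊢
    rw [Equiv.Perm.coe_mul, ← Finset.image_image, hσ, hτ']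
  · intro σ hσ
    simp only [Finset.mem_filter, Finset.mem_univ, true_and] at hσ ⊢
    rw [Equiv.Perm.coe_mul, ← Finset.image_image, hσ, ← hτ', Finset.image_image,
      ← Equiv.Perm.coe_mul, inv_mul_cancel]
    simp
  · simp
  · simp

lemma card_perm_image_subset_eq (A B : Finset α) :
    (Finset.univ.filter fun σ : Equiv.Perm α => A.image σ ⊆ B).card =
      B.card.choose A.card *
        (Finset.univ.filter fun σ : Equiv.Perm α => A.image σ = A).card := by
  rw [Finset.card_eq_sum_card_fiberwise (f := fun σ : Equiv.Perm α => A.image σ)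
    (t := B.powersetCard A.card)]
  · rw [← Finset.card_powersetCard, ← smul_eq_mul, ← Finset.sum_const]
    refine Finset.sum_congr rfl fun C hC => ?_
    rw [Finset.mem_powersetCard] at hC
    rw [← card_perm_image_eq A C hC.2.symm, Finset.filter_filter]
    congr 1
    ext σ
    simp only [Finset.mem_filter, Finset.mem_univ, true_and, and_iff_right_iff_imp]
    rintro rfl
    exact hC.1
  · intro σ hσ
    simp only [Finset.coe_filter, Finset.mem_univ, true_and, Set.mem_ofPred_eq] at hσ
    simp only [Finset.mem_coe, Finset.mem_powersetCard]
    exact ⟨hσ, Finset.card_image_of_injective _ σ.injective⟩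

/-- A uniformly random permutation maps `A` into `B` with probability
`C(|B|, |A|) / C(|α|, |A|)`. -/
lemma card_perm_image_subset_mul (A B : Finset α) :
    (Finset.univ.filter fun σ : Equiv.Perm α => A.image σ ⊆ B).card *
        (Fintype.card α).choose A.card =
      B.card.choose A.card * (Fintype.card α).factorial := by
  have h := card_perm_image_subset_eq A Finset.univ
  simp only [Finset.subset_univ, Finset.filter_true, Finset.card_univ, Fintype.card_perm] at h
  rw [card_perm_image_subset_eq, h]
  ring

end Counting

/-! ### Families whose unions are large -/

/-- The family of triples read off a pairing of `3n` set slots with `3n` copies of the `n`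
elements (three each). -/
def tripleFamily {n : ℕ} (σ : Equiv.Perm (Fin n × Fin 3)) (i : Fin n) : Finset (Fin n) :=
  Finset.univ.image fun j : Fin 3 => (σ (i, j)).1

/-- If fewer than one bad pair is expected, some family of triples has all its unions of `k`
members larger than `n - k`. -/
lemma exists_family_large_unions {n k : ℕ} (hk : k ≤ n)
    (h : n.choose k * n.choose k * (3 * (n - k)).choose (3 * k) < (3 * n).choose (3 * k)) :
    ∃ X ∈ setFamilies 3 n n, ∀ S : Finset (Fin n), S.card = k → n - k < (S.biUnion X).card := by
  set P : Finset (Finset (Fin n) × Finset (Fin n)) :=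
    Finset.univ.powersetCard k ×ˢ Finset.univ.powersetCard (n - k) with hP
  set bad : Finset (Fin n) × Finset (Fin n) → Finset (Equiv.Perm (Fin n × Fin 3)) := fun p =>
    Finset.univ.filter fun σ => (p.1 ×ˢ Finset.univ).image σ ⊆ p.2 ×ˢ Finset.univ with hbad
  have hcard : ∀ p ∈ P, (bad p).card * (3 * n).choose (3 * k) =
      (3 * (n - k)).choose (3 * k) * (3 * n).factorial := by
    intro p hp
    simp only [hP, Finset.mem_product, Finset.mem_powersetCard] at hp
    have := card_perm_image_subset_mul (p.1 ×ˢ (Finset.univ : Finset (Fin 3)))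
      (p.2 ×ˢ (Finset.univ : Finset (Fin 3)))
    simp only [Finset.card_product, hp.1.2, hp.2.2, Finset.card_univ, Fintype.card_prod,
      Fintype.card_fin] at this
    simpa only [hbad, mul_comm 3] using this
  have hlt : (P.biUnion bad).card < (3 * n).factorial := by
    refine lt_of_mul_lt_mul_right ?_ (Nat.zero_le ((3 * n).choose (3 * k)))
    calc (P.biUnion bad).card * (3 * n).choose (3 * k)
        ≤ (∑ p ∈ P, (bad p).card) * (3 * n).choose (3 * k) :=
          Nat.mul_le_mul_right _ Finset.card_biUnion_le
      _ = P.card * ((3 * (n - k)).choose (3 * k) * (3 * n).factorial) := by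
          rw [Finset.sum_mul, Finset.sum_congr rfl hcard, Finset.sum_const, smul_eq_mul]
      _ = n.choose k * n.choose k * (3 * (n - k)).choose (3 * k) * (3 * n).factorial := by
          simp only [hP, Finset.card_product, Finset.card_powersetCard, Finset.card_univ,
            Fintype.card_fin, Nat.choose_symm hk]
          ring
      _ < (3 * n).factorial * (3 * n).choose (3 * k) := by
          rw [mul_comm]
          exact Nat.mul_lt_mul_of_pos_left h (Nat.factorial_pos _)
  obtain ⟨σ, hσ⟩ : ∃ σ, σ ∉ P.biUnion bad := by
    by_contra! hall
    have : P.biUnion bad = Finset.univ := Finset.eq_univ_iff_forall.2 hall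
    rw [this, Finset.card_univ, Fintype.card_perm, Fintype.card_prod, Fintype.card_fin,
      Fintype.card_fin, mul_comm] at hlt
    exact lt_irrefl _ hlt
  refine ⟨tripleFamily σ, fun i => Finset.card_image_le, fun S hS => ?_⟩
  by_contra! hle
  obtain ⟨W, hW, -, hWc⟩ := Finset.exists_subsuperset_card_eq
    (Finset.subset_univ (S.biUnion (tripleFamily σ))) hle (by simp)
  refine hσ (Finset.mem_biUnion.2 ⟨(S, W), ?_, ?_⟩)
  · simp [hP, hS, hWc]
  · simp only [hbad, Finset.mem_filter, Finset.mem_univ, true_and]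
    intro q hq
    obtain ⟨⟨i, j⟩, hij, rfl⟩ := Finset.mem_image.1 hq
    simp only [Finset.mem_product, Finset.mem_univ, and_true] at hij ⊢
    exact hW (Finset.mem_biUnion.2 ⟨i, hij, Finset.mem_image.2 ⟨j, Finset.mem_univ _, rfl⟩⟩)

/-- Each ordering is judged at the position `k`. -/
lemma le_orderingExponent {c n m k u : ℕ} (hk1 : 1 ≤ k) (hkm : k ≤ m)
    {X : Fin m → Finset (Fin n)} (hX : X ∈ setFamilies c n m)
    (h : ∀ S : Finset (Fin m), S.card = k → u ≤ (S.biUnion X).card) :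
    (u : ℤ) - k ≤ orderingExponent c n m := by
  refine le_trans ?_ ((isGreatest_orderingExponent c n m).2 ⟨X, hX, rfl⟩)
  obtain ⟨π, hπ⟩ := (isLeast_deltaMin X).1
  rw [← hπ]
  refine le_trans ?_ ((isGreatest_deltaOrder (hk1.trans hkm) X π).2 ⟨k, ⟨hk1, hkm⟩, rfl⟩)
  unfold deltaAt
  have hc : (Finset.univ.filter fun i : Fin m => (i : ℕ) < k).card = k := by
    rw [Fin.card_filter_val_lt, min_eq_right hkm]
  have := h ((Finset.univ.filter fun i : Fin m => (i : ℕ) < k).image π)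
    (by rw [Finset.card_image_of_injective _ π.injective, hc])
  rw [Finset.image_biUnion] at this
  have : (u : ℤ) ≤ _ := Int.ofNat_le.2 this
  exact sub_le_sub_right this _

lemma eventually_le_orderingExponent :
    ∀ᶠ n : ℕ in atTop, (0.0818757697 : ℝ) * (n : ℝ) ≤ (orderingExponent 3 n n : ℝ) := by
  filter_upwards [eventually_union_bound, eventually_ge_atTop 3] with n hn hn3
  obtain ⟨k, hk⟩ : ∃ k : ℕ, k = ⌊(1 - 0.0818757697) / 2 * (n : ℝ)⌋₊ := ⟨_, rfl⟩
  have hn3' : (3 : ℝ) ≤ n := by exact_mod_cast hn3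
  have hk1 : 1 ≤ k := by
    rw [hk, Nat.one_le_floor_iff]
    linarith
  have hkle : (k : ℝ) ≤ (1 - 0.0818757697) / 2 * (n : ℝ) := by
    rw [hk]; exact Nat.floor_le (by positivity)
  have hkn : k ≤ n := by
    have : (k : ℝ) ≤ n := by linarith
    exact_mod_cast this
  obtain ⟨X, hX, hS⟩ := exists_family_large_unions hkn (hn k hk)
  have key := le_orderingExponent hk1 hkn hX hS
  have key' : ((n - k + 1 : ℕ) : ℝ) - k ≤ (orderingExponent 3 n n : ℝ) := by exact_mod_cast key
  rw [Nat.cast_add, Nat.cast_sub hkn] at key'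
  push_cast at key'
  linarith

/-! ### The gap along an increasing chain of sets -/

/-- Two elements outside `U` are adjacent if some set of the family lacks exactly these two. -/
def pairGraph {ι α : Type*} [DecidableEq α] (X : ι → Finset α) (U : Finset α) : SimpleGraph α :=
  SimpleGraph.fromRel fun x y => ∃ i, X i \ U = {x, y}

lemma exists_sdiff_eq_of_adj {ι α : Type*} [DecidableEq α] {X : ι → Finset α} {U : Finset α} {x y : α}
    (h : (pairGraph X U).Adj x y) : ∃ i, X i \ U = {x, y} := by
  rw [pairGraph, SimpleGraph.fromRel_adj] at h
  rcases h.2 with h | ⟨i, hi⟩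
  · exact h
  · exact ⟨i, by rw [hi, Finset.pair_comm]⟩

section Gap

variable {ι α : Type*} [Fintype ι] [DecidableEq α]

/-- The number of elements of `U` minus the number of members of the family that lie inside `U`.
Ordering the sets by the moment at which an increasing chain of `U`s swallows them bounds `Δ` by the
gaps met along the chain. -/
def gap (X : ι → Finset α) (U : Finset α) : ℤ :=
  (U.card : ℤ) - (Finset.univ.filter fun i => X i ⊆ U).card

/-- The number of members of the family that meet `U`. -/
def touched (X : ι → Finset α) (U : Finset α) : ℕ :=
  (Finset.univ.filter fun i => ¬ Disjoint (X i) U).card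

/-- Adding one new element to a set of gap at most `B`. The gap of the result is not constrained, so
that a path bounds the gaps of all its members but the last. -/
def GrowStep (X : ι → Finset α) (B : ℤ) (U V : Finset α) : Prop :=
  gap X U ≤ B ∧ ∃ x ∉ U, V = insert x U

lemma GrowStep.mono {X : ι → Finset α} {B B' : ℤ} (h : B ≤ B') {U V : Finset α}
    (hs : GrowStep X B U V) : GrowStep X B' U V :=
  ⟨hs.1.trans h, hs.2⟩

lemma touched_mono (X : ι → Finset α) {U V : Finset α} (h : U ⊆ V) :
    touched X U ≤ touched X V := by
  refine Finset.card_le_card fun i hi => ?_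
  simp only [Finset.mem_filter, Finset.mem_univ, true_and] at hi ⊢
  exact fun hd => hi (hd.mono_right h)

lemma gap_insert_le (X : ι → Finset α) (U : Finset α) (x : α) :
    gap X (insert x U) ≤ gap X U + 1 := by
  have h1 := Finset.card_insert_le x U
  have h2 : (Finset.univ.filter fun i => X i ⊆ U).card ≤
      (Finset.univ.filter fun i => X i ⊆ insert x U).card := by
    refine Finset.card_le_card fun i hi => ?_
    simp only [Finset.mem_filter, Finset.mem_univ, true_and] at hi ⊢
    exact hi.trans (Finset.subset_insert _ _)
  unfold gap
  omega

/-- An element that completes a set of the family is added for free. -/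
lemma gap_insert_le_of_subset (X : ι → Finset α) {U : Finset α} {x : α} {i : ι}
    (hi : ¬ X i ⊆ U) (hi' : X i ⊆ insert x U) : gap X (insert x U) ≤ gap X U := by
  have h1 := Finset.card_insert_le x U
  have h2 : (Finset.univ.filter fun i => X i ⊆ U).card <
      (Finset.univ.filter fun i => X i ⊆ insert x U).card := by
    refine Finset.card_lt_card ⟨fun i hi => ?_, fun h => ?_⟩
    · simp only [Finset.mem_filter, Finset.mem_univ, true_and] at hi ⊢
      exact hi.trans (Finset.subset_insert _ _)
    · exact hi (Finset.mem_filter.1 (h (Finset.mem_filter.2 ⟨Finset.mem_univ _, hi'⟩))).2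
  unfold gap
  omega

lemma exists_chain_of_path {X : ι → Finset α} {B : ℤ} {U : Finset α}
    (h : Relation.ReflTransGen (GrowStep X B) ∅ U) :
    ∃ S : ℕ → Finset α, Monotone S ∧ S 0 = ∅ ∧ S U.card = U ∧
      ∀ j < U.card, (S j).card = j ∧ gap X (S j) ≤ B := by
  induction h with
  | refl => exact ⟨fun _ => ∅, monotone_const, rfl, rfl, by simp⟩
  | @tail V W _ hs ih =>
    obtain ⟨S, hm, h0, hV, hS⟩ := ih
    obtain ⟨hB, x, hx, rfl⟩ := hs
    refine ⟨fun j => if j ≤ V.card then S j else insert x V, ?_, by simpa using h0, ?_, ?_⟩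
    · intro a b hab
      by_cases hb : b ≤ V.card
      · simpa [hb, hab.trans hb] using hm hab
      · by_cases ha : a ≤ V.card
        · simp only [ha, hb, if_true, if_false]
          exact ((hm ha).trans hV.le).trans (Finset.subset_insert _ _)
        · simp [ha, hb]
    · simp [Finset.card_insert_of_notMem hx]
    · intro j hj
      rw [Finset.card_insert_of_notMem hx, Nat.lt_succ_iff] at hj
      simp only [hj, if_true]
      rcases hj.lt_or_eq with h | rfl
      · exact hS j h
      · rw [hV]; exact ⟨rfl, hB⟩

variable [Fintype α]

/-! ### Adding components of pairs -/

/-- The members outside `U` of the class of label `κ`. -/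
def block {γ : Type*} [DecidableEq γ] (U : Finset α) (c : α → γ) (κ : γ) : Finset α :=
  Finset.univ.filter fun y => y ∉ U ∧ c y = κ

lemma mem_block {γ : Type*} [DecidableEq γ] {U : Finset α} {c : α → γ} {κ : γ} {y : α} :
    y ∈ block U c κ ↔ y ∉ U ∧ c y = κ := by
  simp [block]

open Classical in
/-- Once one element of a connected component of `pairGraph X U` is in, the others follow for
free. -/
lemma component_path (X : ι → Finset α) {U : Finset α} {x : α} (hx : x ∉ U) :
    Relation.ReflTransGen (GrowStep X (gap X U + 1)) U
        (U ∪ block U (pairGraph X U).connectedComponentMk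
          ((pairGraph X U).connectedComponentMk x)) ∧
      gap X (U ∪ block U (pairGraph X U).connectedComponentMk
          ((pairGraph X U).connectedComponentMk x)) ≤ gap X (insert x U) := by
  set G := pairGraph X U with hG
  set C := block U G.connectedComponentMk (G.connectedComponentMk x) with hC
  have hxC : x ∈ C := mem_block.2 ⟨hx, rfl⟩
  -- a largest set on the way, short of the component only if an edge leaves it
  obtain ⟨V, hV, hmax⟩ := (Finset.univ.filter fun V : Finset α => insert x U ⊆ V ∧ V ⊆ U ∪ C ∧
      Relation.ReflTransGen (GrowStep X (gap X U + 1)) U V ∧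
      gap X V ≤ gap X (insert x U)).exists_max_image Finset.card
    ⟨insert x U, by
      simp only [Finset.mem_filter, Finset.mem_univ, true_and]
      refine ⟨subset_rfl, Finset.insert_subset (by simp [hxC]) Finset.subset_union_left,
        .single ⟨by omega, x, hx, rfl⟩, le_rfl⟩⟩
  simp only [Finset.mem_filter, Finset.mem_univ, true_and] at hV hmax
  obtain ⟨hxV, hVC, hpath, hgap⟩ := hV
  suffices h : V = U ∪ C by rw [← h]; exact ⟨hpath, hgap⟩
  by_contra hne
  obtain ⟨y, hy, hyV⟩ : ∃ y ∈ U ∪ C, y ∉ V := by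
    by_contra! h
    exact hne (hVC.antisymm h)
  have hyU : y ∉ U := fun h => hyV (hxV (Finset.mem_insert_of_mem h))
  have hyC : y ∈ C := by simpa [hyU] using hy
  obtain ⟨w⟩ := SimpleGraph.ConnectedComponent.exact (mem_block.1 hyC).2.symm
  obtain ⟨d, hdw, hd1, hd2⟩ := w.exists_boundary_dart V
    (by simpa using hxV (Finset.mem_insert_self _ _)) (by simpa using hyV)
  obtain ⟨i, hi⟩ := exists_sdiff_eq_of_adj d.adj
  have hb : d.snd ∉ V := by simpa using hd2
  have hbU : d.snd ∉ U := fun h => hb (hxV (Finset.mem_insert_of_mem h))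
  have haV : d.fst ∈ V := by simpa using hd1
  have haU : d.fst ∉ U := by
    have : d.fst ∈ X i \ U := by rw [hi]; simp
    exact (Finset.mem_sdiff.1 this).2
  have haC : d.fst ∈ C := by
    have := hVC haV
    simpa [haU] using this
  have hbC : d.snd ∈ C := by
    refine mem_block.2 ⟨hbU, ?_⟩
    rw [← (mem_block.1 haC).2]
    exact SimpleGraph.ConnectedComponent.sound d.adj.symm.reachable
  have hins : gap X (insert d.snd V) ≤ gap X V := by
    refine gap_insert_le_of_subset X (i := i) (fun h => hb (h ?_)) fun z hz => ?_
    · have : d.snd ∈ X i \ U := by rw [hi]; simp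
      exact (Finset.mem_sdiff.1 this).1
    · by_cases hzU : z ∈ U
      · exact Finset.mem_insert_of_mem (hxV (Finset.mem_insert_of_mem hzU))
      · have : z ∈ X i \ U := Finset.mem_sdiff.2 ⟨hz, hzU⟩
        rw [hi, Finset.mem_insert, Finset.mem_singleton] at this
        rcases this with rfl | rfl
        · exact Finset.mem_insert_of_mem haV
        · exact Finset.mem_insert_self _ _
  have := hmax (insert d.snd V) ⟨hxV.trans (Finset.subset_insert _ _),
    Finset.insert_subset (Finset.mem_union_right _ hbC) hVC,
    hpath.tail ⟨hgap.trans (gap_insert_le X U x), _, hb, rfl⟩, hins.trans hgap⟩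
  rw [Finset.card_insert_of_notMem hb] at this
  omega

/-- If no class of the partition `c` lowers the gap, then at least `τ + gap X U` sets lie in no
single class, where `τ` is the number of classes. They avoid `U` and meet two classes each, whence
one class meets three of them. -/
lemma exists_block_touching_three {γ : Type*} [DecidableEq γ] (X : ι → Finset α)
    (hcard : Fintype.card ι = Fintype.card α) (hX : ∀ i, (X i).card ≤ 3) (U : Finset α)
    (c : α → γ) (hc : ∀ i, (X i \ U).card ≤ 2 → ∀ x ∈ X i \ U, ∀ y ∈ X i \ U, c x = c y)
    (hgap : ∀ x ∉ U, gap X (U ∪ block U c (c x)) = gap X U + 1) (hpos : 1 ≤ gap X U) :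
    gap X U + touched X U ≤ Fintype.card α ∧
      ∃ x ∉ U, touched X U + 3 ≤ touched X (U ∪ block U c (c x)) := by
  classical
  set K := Uᶜ.image c with hK
  set inU := Finset.univ.filter fun i => X i ⊆ U with hinU
  set inside : γ → Finset ι := fun κ =>
    Finset.univ.filter fun i => ¬ X i ⊆ U ∧ X i ⊆ U ∪ block U c κ with hinside
  set cross := Finset.univ.filter fun i => ¬ X i ⊆ U ∧ ∀ κ ∈ K, ¬ X i ⊆ U ∪ block U c κ with hcross
  have hblock : ∀ κ ∈ K, (block U c κ).card = (inside κ).card + 1 := by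
    intro κ hκ
    obtain ⟨x, hx, rfl⟩ := Finset.mem_image.1 hκ
    have h := hgap x (Finset.mem_compl.1 hx)
    have hd : Disjoint U (block U c (c x)) :=
      Finset.disjoint_right.2 fun y hy => (mem_block.1 hy).1
    have hsplit : (Finset.univ.filter fun i => X i ⊆ U ∪ block U c (c x)).card =
        inU.card + (inside (c x)).card := by
      rw [← Finset.card_union_of_disjoint]
      · congr 1
        ext i
        simp only [hinU, hinside, Finset.mem_filter, Finset.mem_univ, true_and, Finset.mem_union]
        have : X i ⊆ U → X i ⊆ U ∪ block U c (c x) := fun h => h.trans Finset.subset_union_left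
        tauto
      · exact Finset.disjoint_left.2 fun i h1 h2 =>
          (Finset.mem_filter.1 h2).2.1 (Finset.mem_filter.1 h1).2
    have e1 : gap X U = (U.card : ℤ) - inU.card := rfl
    rw [e1, gap, hsplit, Finset.card_union_of_disjoint hd] at h
    push_cast at h
    omega
  have hcompl : Uᶜ.card = ∑ κ ∈ K, (block U c κ).card := by
    rw [Finset.card_eq_sum_card_image c Uᶜ]
    refine Finset.sum_congr rfl fun κ _ => congrArg _ ?_
    ext y
    simp [mem_block]
  have hinside_disj : Set.PairwiseDisjoint (K : Set γ) inside := by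
    intro κ _ κ' _ hne
    refine Finset.disjoint_left.2 fun i h1 h2 => hne ?_
    simp only [hinside, Finset.mem_filter, Finset.mem_univ, true_and] at h1 h2
    obtain ⟨y, hy, hyU⟩ := Finset.not_subset.1 h1.1
    have e1 := h1.2 hy
    have e2 := h2.2 hy
    simp only [Finset.mem_union, hyU, mem_block, false_or] at e1 e2
    exact e1.2.symm.trans e2.2
  have htotal : Fintype.card ι = inU.card + ∑ κ ∈ K, (inside κ).card + cross.card := by
    rw [← Finset.card_biUnion hinside_disj, ← Finset.card_union_of_disjoint,
      ← Finset.card_union_of_disjoint, ← Finset.card_univ]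
    · congr 1
      ext i
      simp only [hinU, hinside, hcross, Finset.mem_filter, Finset.mem_univ, true_and,
        Finset.mem_union, Finset.mem_biUnion]
      by_cases h : X i ⊆ U
      · simp [h]
      · by_cases h' : ∃ κ ∈ K, X i ⊆ U ∪ block U c κ
        · simpa [h] using Or.inl h'
        · push Not at h'
          simpa [h] using Or.inr h'
    · refine Finset.disjoint_left.2 fun i h1 h2 => ?_
      have h2 := (Finset.mem_filter.1 h2).2
      rcases Finset.mem_union.1 h1 with h1 | h1
      · exact h2.1 (Finset.mem_filter.1 h1).2
      · obtain ⟨κ, hκ, h1⟩ := Finset.mem_biUnion.1 h1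
        exact h2.2 κ hκ (Finset.mem_filter.1 h1).2.2
    · refine Finset.disjoint_left.2 fun i h1 h2 => ?_
      obtain ⟨κ, -, h2⟩ := Finset.mem_biUnion.1 h2
      exact (Finset.mem_filter.1 h2).2.1 (Finset.mem_filter.1 h1).2
  have hcross_card : (cross.card : ℤ) = K.card + gap X U := by
    have h1 : Uᶜ.card = ∑ κ ∈ K, (inside κ).card + K.card := by
      rw [hcompl, Finset.sum_congr rfl hblock, Finset.sum_add_distrib]
      simp
    have h2 := Finset.card_add_card_compl U
    have h3 : gap X U = (U.card : ℤ) - inU.card := rfl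
    omega
  have hlabels : ∀ i ∈ cross, 2 ≤ ((X i \ U).image c).card := by
    intro i hi
    simp only [hcross, Finset.mem_filter, Finset.mem_univ, true_and] at hi
    by_contra! hlt
    obtain ⟨y, hy, hyU⟩ := Finset.not_subset.1 hi.1
    refine hi.2 (c y) (Finset.mem_image_of_mem _ (Finset.mem_compl.2 hyU)) fun z hz => ?_
    by_cases hzU : z ∈ U
    · exact Finset.mem_union_left _ hzU
    · refine Finset.mem_union_right _ (mem_block.2 ⟨hzU, ?_⟩)
      exact Finset.card_le_one.1 (Nat.lt_succ_iff.1 hlt) _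
        (Finset.mem_image_of_mem _ (Finset.mem_sdiff.2 ⟨hz, hzU⟩)) _
        (Finset.mem_image_of_mem _ (Finset.mem_sdiff.2 ⟨hy, hyU⟩))
  have huntouched : ∀ i ∈ cross, Disjoint (X i) U := by
    intro i hi
    have h2 : 3 ≤ (X i \ U).card := by
      by_contra! hlt
      have := hlabels i hi
      obtain ⟨a, ha, b, hb, hab⟩ := Finset.one_lt_card.1 this
      obtain ⟨x, hx, rfl⟩ := Finset.mem_image.1 ha
      obtain ⟨y, hy, rfl⟩ := Finset.mem_image.1 hb
      exact hab (hc i (by omega) x hx y hy)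
    have := Finset.eq_of_subset_of_card_le Finset.sdiff_subset ((hX i).trans h2)
    exact Finset.sdiff_eq_self_iff_disjoint.1 this
  have htouch : touched X U + cross.card ≤ Fintype.card ι := by
    unfold touched
    rw [← Finset.card_union_of_disjoint]
    · exact Finset.card_le_univ _
    · exact Finset.disjoint_left.2 fun i h1 h2 =>
        (Finset.mem_filter.1 h1).2 (huntouched i h2)
  refine ⟨by omega, ?_⟩
  -- double count the incidences between crossing sets and classes
  have hcount : ∑ κ ∈ K, (cross.filter fun i => κ ∈ (X i \ U).image c).card =
      ∑ i ∈ cross, ((X i \ U).image c).card := by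
    have := Finset.sum_card_bipartiteAbove_eq_sum_card_bipartiteBelow
      (s := K) (t := cross) (fun κ i => κ ∈ (X i \ U).image c)
    simp only [Finset.bipartiteAbove, Finset.bipartiteBelow] at this
    rw [this]
    refine Finset.sum_congr rfl fun i _ => congrArg _ ?_
    rw [Finset.filter_mem_eq_inter]
    refine Finset.inter_eq_right.2 (Finset.image_subset_image fun z hz => ?_)
    exact Finset.mem_compl.2 (Finset.mem_sdiff.1 hz).2
  have hsum : ∑ κ ∈ K, 2 < ∑ κ ∈ K, (cross.filter fun i => κ ∈ (X i \ U).image c).card := by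
    rw [hcount]
    have : ∑ i ∈ cross, 2 ≤ ∑ i ∈ cross, ((X i \ U).image c).card := Finset.sum_le_sum hlabels
    simp only [Finset.sum_const, smul_eq_mul] at this ⊢
    omega
  obtain ⟨κ, hκ, h3⟩ := Finset.exists_lt_of_sum_lt hsum
  obtain ⟨x, hx, rfl⟩ := Finset.mem_image.1 hκ
  refine ⟨x, Finset.mem_compl.1 hx, ?_⟩
  refine (Nat.add_le_add_left h3 _).trans ?_
  unfold touched
  rw [← Finset.card_union_of_disjoint]
  · refine Finset.card_le_card fun i hi => ?_
    simp only [Finset.mem_union, Finset.mem_filter, Finset.mem_univ, true_and] at hi ⊢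
    rcases hi with hi | ⟨-, hi⟩
    · exact fun h => hi (h.mono_right Finset.subset_union_left)
    · obtain ⟨y, hy, hyx⟩ := Finset.mem_image.1 hi
      rw [Finset.mem_sdiff] at hy
      exact Finset.not_disjoint_iff.2
        ⟨y, hy.1, Finset.mem_union_right _ (mem_block.2 ⟨hy.2, hyx⟩)⟩
  · exact Finset.disjoint_left.2 fun i h1 h2 =>
      (Finset.mem_filter.1 h1).2 (huntouched i (Finset.mem_filter.1 h2).1)

/-- The greedy step, with the invariant that a gap of `g` has cost at least `3 (g - 1)` touched
sets. When every component raises a positive gap, at least `gap X U` sets are untouched, so that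
`4 gap X U ≤ n + 3` and there is room for one more unit. -/
lemma exists_growth (X : ι → Finset α) (hcard : Fintype.card ι = Fintype.card α)
    (hX : ∀ i, (X i).card ≤ 3) {U : Finset α} (hU : U ≠ Finset.univ) {q : ℤ} (hq : 0 ≤ q)
    (hnq : (Fintype.card α : ℤ) ≤ 4 * q)
    (h1 : 3 * (gap X U - 1) ≤ touched X U) (h2 : gap X U ≤ q + 1) :
    ∃ V, U ⊂ V ∧ Relation.ReflTransGen (GrowStep X (q + 2)) U V ∧
      3 * (gap X V - 1) ≤ touched X V ∧ gap X V ≤ q + 1 := by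
  classical
  set c := (pairGraph X U).connectedComponentMk with hc
  have hss : ∀ x ∉ U, U ⊂ U ∪ block U c (c x) := fun x hx =>
    ⟨Finset.subset_union_left, fun h =>
      hx (h (Finset.mem_union_right _ (mem_block.2 ⟨hx, rfl⟩)))⟩
  have hpath : ∀ x ∉ U, Relation.ReflTransGen (GrowStep X (q + 2)) U (U ∪ block U c (c x)) :=
    fun x hx => (component_path X hx).1.lift id fun _ _ h => h.mono (by omega)
  have hle : ∀ x ∉ U, gap X (U ∪ block U c (c x)) ≤ gap X (insert x U) :=
    fun x hx => (component_path X hx).2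
  have hle' : ∀ x ∉ U, gap X (U ∪ block U c (c x)) ≤ gap X U + 1 :=
    fun x hx => (hle x hx).trans (gap_insert_le X U x)
  by_cases hgain : ∃ x ∉ U, gap X (U ∪ block U c (c x)) ≤ gap X U
  · obtain ⟨x, hx, hg⟩ := hgain
    have := touched_mono X (hss x hx).1
    exact ⟨_, hss x hx, hpath x hx, by omega, by omega⟩
  · push Not at hgain
    by_cases hpos : 1 ≤ gap X U
    · have hsmall : ∀ i, (X i \ U).card ≤ 2 → ∀ x ∈ X i \ U, ∀ y ∈ X i \ U, c x = c y := by
        intro i hi x hx y hy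
        rcases eq_or_ne x y with rfl | hxy
        · rfl
        · have hpair : X i \ U = {x, y} := by
            symm
            refine Finset.eq_of_subset_of_card_le ?_ ?_
            · exact Finset.insert_subset hx (Finset.singleton_subset_iff.2 hy)
            · rw [Finset.card_pair hxy]; exact hi
          refine SimpleGraph.ConnectedComponent.sound (SimpleGraph.Adj.reachable ?_)
          rw [pairGraph, SimpleGraph.fromRel_adj]
          exact ⟨hxy, Or.inl ⟨i, hpair⟩⟩
      obtain ⟨ht, x, hx, h3⟩ := exists_block_touching_three X hcard hX U c hsmall
        (fun x hx => le_antisymm (hle' x hx) (hgain x hx)) hpos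
      have := hle' x hx
      exact ⟨_, hss x hx, hpath x hx, by omega, by omega⟩
    · obtain ⟨x, hx⟩ : ∃ x, x ∉ U := by
        by_contra! h
        exact hU (Finset.eq_univ_iff_forall.2 h)
      have := hle' x hx
      exact ⟨_, hss x hx, hpath x hx, by omega, by omega⟩

lemma exists_path_univ (X : ι → Finset α) (hcard : Fintype.card ι = Fintype.card α)
    (hX : ∀ i, (X i).card ≤ 3) {q : ℤ} (hq : 0 ≤ q) (hnq : (Fintype.card α : ℤ) ≤ 4 * q) :
    Relation.ReflTransGen (GrowStep X (q + 2)) ∅ Finset.univ := by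
  classical
  have hempty : gap X ∅ ≤ 0 := by simp [gap]
  obtain ⟨U, hU, hmax⟩ := (Finset.univ.filter fun U : Finset α =>
      Relation.ReflTransGen (GrowStep X (q + 2)) ∅ U ∧
      3 * (gap X U - 1) ≤ touched X U ∧ gap X U ≤ q + 1).exists_max_image Finset.card
    ⟨∅, by
      simp only [Finset.mem_filter, Finset.mem_univ, true_and]
      exact ⟨.refl, by omega, by omega⟩⟩
  simp only [Finset.mem_filter, Finset.mem_univ, true_and] at hU hmax
  by_cases hne : U = Finset.univ
  · exact hne ▸ hU.1
  · obtain ⟨V, hUV, hp, hV⟩ := exists_growth X hcard hX hne hq hnq hU.2.1 hU.2.2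
    have := Finset.card_lt_card hUV
    exact absurd (hmax V ⟨hU.1.trans hp, hV⟩) (by omega)

end Gap

/-! ### From chains to orderings -/

/-- The sets are ordered by the moment at which the chain swallows them. -/
lemma deltaMin_le_of_path {n m : ℕ} (hm : 1 ≤ m) (X : Fin m → Finset (Fin n)) {B : ℤ} (hB : 0 ≤ B)
    (h : Relation.ReflTransGen (GrowStep X B) ∅ Finset.univ) : deltaMin X ≤ B := by
  obtain ⟨S, hmono, h0, hn, hS⟩ := exists_chain_of_path h
  rw [Finset.card_univ, Fintype.card_fin] at hn hS
  have hex : ∀ i, ∃ j, X i ⊆ S j := fun i => ⟨n, by rw [hn]; exact Finset.subset_univ _⟩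
  set t : Fin m → ℕ := fun i => Nat.find (hex i) with ht
  have htn : ∀ i, t i ≤ n := fun i => Nat.find_min' _ (by rw [hn]; exact Finset.subset_univ _)
  refine ((isLeast_deltaMin X).2 ⟨Tuple.sort t, rfl⟩).trans ?_
  obtain ⟨k, ⟨hk1, hkm⟩, hk⟩ := (isGreatest_deltaOrder hm X (Tuple.sort t)).1
  rw [← hk]
  have hsort : Monotone (t ∘ Tuple.sort t) := Tuple.monotone_sort t
  obtain ⟨k, rfl⟩ : ∃ k', k = k' + 1 := ⟨k - 1, by omega⟩
  set p : Fin m := ⟨k, by omega⟩ with hp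
  have hunion : ((Finset.univ.filter fun i : Fin m => (i : ℕ) < k + 1).biUnion
      fun i => X (Tuple.sort t i)) ⊆ S (t (Tuple.sort t p)) := by
    refine Finset.biUnion_subset.2 fun i hi => ?_
    have hip : i ≤ p := by
      rw [Fin.le_def]
      exact Nat.lt_succ_iff.1 (Finset.mem_filter.1 hi).2
    exact (Nat.find_spec (hex _)).trans (hmono (hsort hip))
  have hc := Finset.card_le_card hunion
  unfold deltaAt
  rcases Nat.eq_zero_or_pos (t (Tuple.sort t p)) with hz | hpos
  · rw [hz, h0, Finset.card_empty] at hc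
    push_cast
    omega
  · obtain ⟨j, hj⟩ : ∃ j, t (Tuple.sort t p) = j + 1 := ⟨_, (Nat.succ_pred_eq_of_pos hpos).symm⟩
    have hjn : j + 1 ≤ n := hj ▸ htn _
    have hSj : (S (j + 1)).card = j + 1 := by
      rcases hjn.lt_or_eq with h | h
      · exact (hS _ h).1
      · rw [h, hn, Finset.card_univ, Fintype.card_fin]
    -- only the sets listed before position `k` fit into `S j`
    have hin : (Finset.univ.filter fun i => X i ⊆ S j).card ≤ k := by
      calc (Finset.univ.filter fun i => X i ⊆ S j).card
          ≤ ((Finset.univ.filter fun i : Fin m => (i : ℕ) < k).image (Tuple.sort t)).card := by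
            refine Finset.card_le_card fun i hi => ?_
            rw [Finset.mem_filter] at hi
            refine Finset.mem_image.2 ⟨(Tuple.sort t).symm i, ?_, by simp⟩
            rw [Finset.mem_filter]
            refine ⟨Finset.mem_univ _, ?_⟩
            by_contra! hge
            have hle : p ≤ (Tuple.sort t).symm i := by rw [Fin.le_def]; exact hge
            have h1 := hsort hle
            simp only [Function.comp_apply, Equiv.apply_symm_apply, hj] at h1
            have h2 : t i ≤ j := Nat.find_min' _ hi.2
            omega
        _ ≤ (Finset.univ.filter fun i : Fin m => (i : ℕ) < k).card := Finset.card_image_le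
        _ ≤ k := by rw [Fin.card_filter_val_lt]; exact min_le_right _ _
    obtain ⟨hcj, hgj⟩ := hS j (by omega)
    unfold gap at hgj
    rw [hcj] at hgj
    rw [hj, hSj] at hc
    push_cast
    omega

lemma orderingExponent_three_le {n : ℕ} (hn : 1 ≤ n) :
    orderingExponent 3 n n ≤ ⌈(n : ℝ) / 4⌉ + 2 := by
  obtain ⟨X, hX, hval⟩ := (isGreatest_orderingExponent 3 n n).1
  rw [← hval]
  have hq : (0 : ℤ) ≤ ⌈(n : ℝ) / 4⌉ := Int.ceil_nonneg (by positivity)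
  refine deltaMin_le_of_path hn X (by omega) (exists_path_univ X rfl hX hq ?_)
  have h : (n : ℝ) ≤ 4 * (⌈(n : ℝ) / 4⌉ : ℤ) := by linarith [Int.le_ceil ((n : ℝ) / 4)]
  rw [Fintype.card_fin]
  exact_mod_cast h

theorem theorem1 :
    (∀ᶠ n : ℕ in Filter.atTop,
      (0.0818757697 : ℝ) * (n : ℝ) ≤ (orderingExponent 3 n n : ℝ)) ∧
    (∀ n : ℕ, 3 ≤ n → orderingExponent 3 n n ≤ ⌈(n : ℝ) / 4⌉ + 2) ∧
    (fun n : ℕ => (orderingExponent 3 n n : ℝ)) =Θ[Filter.atTop] (fun n : ℕ => (n : ℝ)) := by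
  have hlow := eventually_le_orderingExponent
  refine ⟨hlow, fun n hn => orderingExponent_three_le (by omega), ?_, ?_⟩
  · refine Asymptotics.IsBigO.of_bound 4 ?_
    filter_upwards [hlow, Filter.eventually_ge_atTop 1] with n h hn
    have hn' : (1 : ℝ) ≤ n := by exact_mod_cast hn
    have hup : (orderingExponent 3 n n : ℝ) ≤ (⌈(n : ℝ) / 4⌉ : ℤ) + 2 := by
      exact_mod_cast orderingExponent_three_le hn
    rw [Real.norm_of_nonneg (le_trans (by positivity) h), Real.norm_of_nonneg (by positivity)]
    linarith [Int.ceil_lt_add_one ((n : ℝ) / 4)]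
  · refine Asymptotics.IsBigO.of_bound 13 ?_
    filter_upwards [hlow] with n h
    rw [Real.norm_of_nonneg (le_trans (by positivity) h), Real.norm_of_nonneg (by positivity)]
    linarith
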